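/- Let $G$ be a connected finite simple graph with $V(G)=\{1,\dots,n\}$ and $E(G)=\{e_1,\dots,e_m\}$. Let $f_1,\dots,f_n,g_1,\dots,g_m$ be the standard basis of $\mathbb{Z}^n\oplus\mathbb{Z}^m$. For each edge $e=e_k=ij$ with $i<j$, set $z(e)=f_i-f_j+g_k$ and $z'(e)=-f_i+f_j+g_k$. Let $N_0$ be the $n\times m$ matrix whose $k$-th column, for $e_k=ij$ with $i<j$, has entry $1$ in row $i$, entry $-1$ in row $j$, and $0$ elsewhere. For $I\subset\{1,\dots,n\}$, let $E(I)$ be the set of edges of $G$ with exactly one end in $I$. Let $r_i$, $s_j$, $a_e\le b_e$, $c_e\le d_e$ be integers ($1\le i\le n$, $1\le j\le m$, $e\in E(G)$). Then there exist integers $a_e\le x_e\le b_e$ and $c_e\le y_e\le d_e$ ($e\in E(G)$) such that $$\sum_{i=1}^n r_i f_i+\sum_{j=1}^m s_j g_j=\sum_{e\in E(G)} x_e z(e)+\sum_{e\in E(G)} y_e z'(e)$$ if and only if the following three conditions hold. (1) With $r=(r_1,\dots,r_n)^T$ and $s=(s_1,\dots,s_m)^T$, every entry $t_i$ of the vector $t=N_0s+r$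 is even, and $\sum_{i=1}^n t_i=0$. (2) For all sets $\emptyset\ne I\subsetneq\{1,\dots,n\}$ and $J\subset E(I)$ such that the induced subgraphs of $G$ on $I$ and on $\{1,\dots,n\}\setminus I$ are connected, $$\sum_{i\in I} r_i+\sum_{e_k\in E(I)\setminus J}s_k-\sum_{e_k\in J}s_k\le 2\sum_{\substack{e=ij\notin J,\ i<j\\ i\in I,\ j\notin I}} b_e-2\sum_{\substack{e=ij\in J,\ i<j\\ i\notin I,\ j\in I}} a_e+2\sum_{\substack{e=ij\notin J,\ i<j\\ i\notin I,\ j\in I}} d_e-2\sum_{\substack{e=ij\in J,\ i<j\\ i\in I,\ j\notin I}} c_e,$$ where all the sums on the right are over edges $e\in E(G)$. (3) For every edge $e=e_k\in E(G)$ such that the graph $G-e_k$ is connected, $a_e+c_e\le s_k\le b_e+d_e$. -/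

import Mathlib

open scoped Matrix

namespace EdgeBox

variable {n m : ℕ} {G : SimpleGraph (Fin n)}

/-- The standard basis vector `f_i` of `ℤⁿ ⊕ ℤᵐ`. -/
def f (m : ℕ) (i : Fin n) : (Fin n → ℤ) × (Fin m → ℤ) := (Pi.single i 1, 0)

/-- The standard basis vector `g_k` of `ℤⁿ ⊕ ℤᵐ`. -/
def g (n : ℕ) (k : Fin m) : (Fin n → ℤ) × (Fin m → ℤ) := (0, Pi.single k 1)

/-- The smaller end of an edge; it is the tail of the edge in the orientation of `G`
from smaller to larger vertices. -/
def lo (e : G.edgeSet) : Fin n := Sym2.inf (e : Sym2 (Fin n))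

/-- The larger end of an edge; it is the head of the edge in the orientation of `G`
from smaller to larger vertices. -/
def hi (e : G.edgeSet) : Fin n := Sym2.sup (e : Sym2 (Fin n))

/-- `z(e) = f_i - f_j + g_k` for the edge `e = e_k = ij` with `i < j`, where `ε` is the
enumeration `e_1, …, e_m` of the edges. -/
def z (ε : Fin m ≃ G.edgeSet) (e : G.edgeSet) : (Fin n → ℤ) × (Fin m → ℤ) :=
  f m (lo e) - f m (hi e) + g n (ε.symm e)

/-- `z'(e) = -f_i + f_j + g_k` for the edge `e = e_k = ij` with `i < j`. -/
def z' (ε : Fin m ≃ G.edgeSet) (e : G.edgeSet) : (Fin n → ℤ) × (Fin m → ℤ) :=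
  -f m (lo e) + f m (hi e) + g n (ε.symm e)

/-- The directed incidence matrix `N_0` of the orientation of `G` in which every edge is
directed from its smaller to its larger end. -/
def N₀ (ε : Fin m ≃ G.edgeSet) : Matrix (Fin n) (Fin m) ℤ :=
  Matrix.of fun i k => if i = lo (ε k) then 1 else if i = hi (ε k) then -1 else 0

/-- `E(I)`: the set of edges of `G` with exactly one end in `I`. -/
def cut (G : SimpleGraph (Fin n)) [DecidableRel G.Adj] (I : Finset (Fin n)) :
    Finset G.edgeSet :=
  Finset.univ.filter fun e => ∃ i ∈ I, ∃ j ∉ I, (e : Sym2 (Fin n)) = s(i, j)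

end EdgeBox

/-! The `g`-coordinates force `y = s - x`, so the two boxes become `max a (s - d) ≤ x ≤ min b (s -
c)`. The `f`-coordinates then say that twice the net outflow of `x` is `t = N₀ s + r`. The question
is thus whether an integral flow with bounds `l ≤ u` and net outflow `t / 2` exists, which Hoffman's
theorem (`exists_flow_of_cut`) decides by cut capacities. The set `J` chooses one of the two bounds
on each cut edge, so the inequalities over all `J` amount to one for the minimal capacity
(`exists_choiceCap_eq`). Cuts with both sides connected suffice, since any other cut splits into
smaller ones (`cut_of_connected_cut`). On a bridge, `l ≤ u` follows from its two opposite cuts, so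
it need only be assumed on other edges. -/

namespace EdgeBox

/-! ### Integral flows and Hoffman's theorem -/

section Network

variable {V E : Type*} [DecidableEq V] (tl hd : E → V)

/-- The contribution of the edge `e` to the capacity of the cut out of `I`, for flows bounded
below by `l` and above by `u`. -/
def cutCap (l u : E → ℤ) (I : Finset V) (e : E) : ℤ :=
  if tl e ∈ I then (if hd e ∈ I then 0 else u e) else (if hd e ∈ I then -l e else 0)

/-- Submodularity, edge by edge: only an edge between `I \ K` and `K \ I` leaves a gap, equal to `u
e - l e`. -/
theorem cutCap_inter_add_union_le {l u : E → ℤ} (I K : Finset V) {e : E} (h : l e ≤ u e) :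
    cutCap tl hd l u (I ∩ K) e + cutCap tl hd l u (I ∪ K) e ≤
      cutCap tl hd l u I e + cutCap tl hd l u K e := by
  by_cases h1 : tl e ∈ I <;> by_cases h2 : tl e ∈ K <;> by_cases h3 : hd e ∈ I <;>
    by_cases h4 : hd e ∈ K <;> simp [cutCap, h1, h2, h3, h4] <;> omega

variable [Fintype E]

/-- The net outflow of `x` at the vertex `i`. -/
def netOut (x : E → ℤ) (i : V) : ℤ :=
  ∑ e, x e * ((if i = tl e then 1 else 0) - (if i = hd e then 1 else 0))

theorem sum_netOut (x : E → ℤ) (I : Finset V) :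
    ∑ i ∈ I, netOut tl hd x i =
      ∑ e, x e * ((if tl e ∈ I then 1 else 0) - (if hd e ∈ I then 1 else 0)) := by
  unfold netOut
  rw [Finset.sum_comm]
  refine Finset.sum_congr rfl fun e _ => ?_
  rw [← Finset.mul_sum, Finset.sum_sub_distrib, Finset.sum_ite_eq', Finset.sum_ite_eq']

theorem sum_cutCap_self (x : E → ℤ) (I : Finset V) :
    ∑ e, cutCap tl hd x x I e = ∑ i ∈ I, netOut tl hd x i := by
  rw [sum_netOut]
  refine Finset.sum_congr rfl fun e _ => ?_
  unfold cutCap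
  split_ifs <;> simp

/-- Uncrossing: two tight cuts separating the ends of `e` in opposite directions force
`u e ≤ l e`. -/
theorem upper_le_lower_of_tight {l u : E → ℤ} (hlu : ∀ e, l e ≤ u e) {τ : V → ℤ}
    (hcut : ∀ I : Finset V, ∑ i ∈ I, τ i ≤ ∑ e, cutCap tl hd l u I e)
    {I K : Finset V} (hI : ∑ e, cutCap tl hd l u I e ≤ ∑ i ∈ I, τ i)
    (hK : ∑ e, cutCap tl hd l u K e ≤ ∑ i ∈ K, τ i) {e : E}
    (h1 : tl e ∈ I) (h2 : hd e ∉ I) (h3 : tl e ∉ K) (h4 : hd e ∈ K) : u e ≤ l e := by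
  by_contra! hlt
  have hsum : ∑ k, (cutCap tl hd l u (I ∩ K) k + cutCap tl hd l u (I ∪ K) k) <
      ∑ k, (cutCap tl hd l u I k + cutCap tl hd l u K k) := by
    refine Finset.sum_lt_sum (fun k _ => cutCap_inter_add_union_le tl hd I K (hlu k))
      ⟨e, Finset.mem_univ e, ?_⟩
    simp [cutCap, h1, h2, h3, h4]
    omega
  rw [Finset.sum_add_distrib, Finset.sum_add_distrib] at hsum
  have := hcut (I ∩ K)
  have := hcut (I ∪ K)
  have := Finset.sum_union_inter (s₁ := I) (s₂ := K) (f := τ)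
  omega

variable [DecidableEq E]

theorem cutCap_update_upper (l u : E → ℤ) (I : Finset V) (e : E) :
    ∑ k, cutCap tl hd l (Function.update u e (u e - 1)) I k =
      ∑ k, cutCap tl hd l u I k - if tl e ∈ I ∧ hd e ∉ I then 1 else 0 := by
  rw [← Finset.add_sum_erase _ _ (Finset.mem_univ e),
    ← Finset.add_sum_erase _ (cutCap tl hd l u I) (Finset.mem_univ e)]
  have h : ∑ k ∈ Finset.univ.erase e, cutCap tl hd l (Function.update u e (u e - 1)) I k =
      ∑ k ∈ Finset.univ.erase e, cutCap tl hd l u I k := by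
    refine Finset.sum_congr rfl fun k hk => ?_
    simp [cutCap, Function.update_of_ne (Finset.ne_of_mem_erase hk)]
  rw [h]
  by_cases h1 : tl e ∈ I <;> by_cases h2 : hd e ∈ I <;> simp [cutCap, h1, h2]

theorem cutCap_update_lower (l u : E → ℤ) (I : Finset V) (e : E) :
    ∑ k, cutCap tl hd (Function.update l e (l e + 1)) u I k =
      ∑ k, cutCap tl hd l u I k - if tl e ∉ I ∧ hd e ∈ I then 1 else 0 := by
  rw [← Finset.add_sum_erase _ _ (Finset.mem_univ e),
    ← Finset.add_sum_erase _ (cutCap tl hd l u I) (Finset.mem_univ e)]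
  have h : ∑ k ∈ Finset.univ.erase e, cutCap tl hd (Function.update l e (l e + 1)) u I k =
      ∑ k ∈ Finset.univ.erase e, cutCap tl hd l u I k := by
    refine Finset.sum_congr rfl fun k hk => ?_
    simp [cutCap, Function.update_of_ne (Finset.ne_of_mem_erase hk)]
  rw [h]
  by_cases h1 : tl e ∈ I <;> by_cases h2 : hd e ∈ I <;> simp [cutCap, h1, h2]
  ring

/-- Hoffman's theorem: an integral flow within bounds `l ≤ u` and with prescribed net outflow `τ`
exists when every cut has enough capacity. -/
theorem exists_flow_of_cut [Fintype V] {τ : V → ℤ} (hτ : ∑ i, τ i = 0) (l u : E → ℤ)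
    (hlu : ∀ e, l e ≤ u e)
    (hcut : ∀ I : Finset V, ∑ i ∈ I, τ i ≤ ∑ e, cutCap tl hd l u I e) :
    ∃ x : E → ℤ, (∀ e, l e ≤ x e ∧ x e ≤ u e) ∧ ∀ i, netOut tl hd x i = τ i := by
  -- Induction on the total slack: some edge with `l e < u e` has its interval shortened by one. If
  -- a tight cut leaves along `e`, so that `u e` cannot drop, uncrossing rules out a tight cut
  -- entered by `e`, so `l e` can rise.
  induction hN : (∑ e, (u e - l e)).toNat using Nat.strong_induction_on generalizing l u with
  | _ N ih =>
  by_cases hex : ∃ e, l e < u e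
  · obtain ⟨e, he⟩ := hex
    have hpos : u e - l e ≤ ∑ k, (u k - l k) :=
      Finset.single_le_sum (f := fun k => u k - l k)
        (fun k _ => sub_nonneg.2 (hlu k)) (Finset.mem_univ e)
    have hsumu : ∑ k, Function.update u e (u e - 1) k = ∑ k, u k - 1 := by
      rw [Finset.sum_update_of_mem (Finset.mem_univ e),
        ← Finset.add_sum_erase _ u (Finset.mem_univ e), Finset.sdiff_singleton_eq_erase]
      ring
    have hsuml : ∑ k, Function.update l e (l e + 1) k = ∑ k, l k + 1 := by
      rw [Finset.sum_update_of_mem (Finset.mem_univ e),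
        ← Finset.add_sum_erase _ l (Finset.mem_univ e), Finset.sdiff_singleton_eq_erase]
      ring
    rw [Finset.sum_sub_distrib] at hN hpos
    by_cases hU : ∀ I : Finset V, tl e ∈ I → hd e ∉ I →
        ∑ i ∈ I, τ i < ∑ k, cutCap tl hd l u I k
    · obtain ⟨x, hx, hxτ⟩ := ih _ (by
          rw [← hN]
          rw [Int.toNat_lt_toNat (by omega)]
          exact (by omega : ∑ k, u k - 1 - ∑ k, l k < ∑ k, u k - ∑ k, l k)) l
        (Function.update u e (u e - 1))
        (fun k => by
          rcases eq_or_ne k e with rfl | hk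
          · simp; omega
          · simp [Function.update_of_ne hk, hlu k])
        (fun I => by
          rw [cutCap_update_upper]
          split_ifs with h
          · have := hU I h.1 h.2; omega
          · simpa using hcut I)
        (by rw [Finset.sum_sub_distrib, hsumu])
      refine ⟨x, fun k => ⟨(hx k).1, (hx k).2.trans ?_⟩, hxτ⟩
      rcases eq_or_ne k e with rfl | hk
      · simp
      · simp [Function.update_of_ne hk]
    · push Not at hU
      obtain ⟨I, h1, h2, hI⟩ := hU
      obtain ⟨x, hx, hxτ⟩ := ih _ (by
          rw [← hN]
          rw [Int.toNat_lt_toNat (by omega)]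
          exact (by omega : ∑ k, u k - (∑ k, l k + 1) < ∑ k, u k - ∑ k, l k))
        (Function.update l e (l e + 1)) u
        (fun k => by
          rcases eq_or_ne k e with rfl | hk
          · simp; omega
          · simp [Function.update_of_ne hk, hlu k])
        (fun K => by
          rw [cutCap_update_lower]
          split_ifs with h
          · by_contra! hK
            have := upper_le_lower_of_tight tl hd hlu hcut hI (by omega) h1 h2 h.1 h.2
            omega
          · simpa using hcut K)
        (by rw [Finset.sum_sub_distrib, hsuml])
      refine ⟨x, fun k => ⟨le_trans ?_ (hx k).1, (hx k).2⟩, hxτ⟩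
      rcases eq_or_ne k e with rfl | hk
      · simp
      · simp [Function.update_of_ne hk]
  · push Not at hex
    obtain rfl : l = u := funext fun e => le_antisymm (hlu e) (hex e)
    refine ⟨l, fun e => ⟨le_rfl, le_rfl⟩, fun i => Eq.symm ?_⟩
    -- Singleton cuts give `τ ≤ netOut` pointwise; both sides have total zero, hence agree.
    have hle : ∀ i ∈ Finset.univ, τ i ≤ netOut tl hd l i := fun i _ => by
      simpa [sum_cutCap_self] using hcut {i}
    refine (Finset.sum_eq_sum_iff_of_le hle).1 ?_ i (Finset.mem_univ i)
    rw [hτ, sum_netOut]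
    simp

end Network

/-! ### Separations of disconnected graphs -/

theorem exists_separation_of_not_connected {W : Type*} [Nonempty W] {H : SimpleGraph W}
    (h : ¬ H.Connected) :
    ∃ A : Set W, A.Nonempty ∧ Aᶜ.Nonempty ∧ ∀ x ∈ A, ∀ y ∉ A, ¬ H.Adj x y := by
  have h' : ¬ H.Preconnected := fun hp => h ⟨hp⟩
  unfold SimpleGraph.Preconnected at h'
  push Not at h'
  obtain ⟨v, w, hvw⟩ := h'
  exact ⟨{y | H.Reachable v y}, ⟨v, SimpleGraph.Reachable.refl v⟩, ⟨w, hvw⟩,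
    fun x hx y hy hxy => hy (hx.trans hxy.reachable)⟩

theorem exists_finset_separation {n : ℕ} {G : SimpleGraph (Fin n)} {I : Finset (Fin n)}
    (hI : I.Nonempty) (h : ¬ (G.induce (I : Set (Fin n))).Connected) :
    ∃ A B : Finset (Fin n), A.Nonempty ∧ B.Nonempty ∧ Disjoint A B ∧ A ∪ B = I ∧
      ∀ x ∈ A, ∀ y ∈ B, ¬ G.Adj x y := by
  classical
  have : Nonempty (I : Set (Fin n)) := hI.to_subtype
  obtain ⟨A, ⟨p, hp⟩, ⟨q, hq⟩, hAB⟩ := exists_separation_of_not_connected h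
  refine ⟨I.filter fun x => ∃ y ∈ A, y.1 = x, I.filter fun x => ¬ ∃ y ∈ A, y.1 = x,
    ⟨p, ?_⟩, ⟨q, ?_⟩, Finset.disjoint_filter_filter_not _ _ _,
    Finset.filter_union_filter_not_eq _ _, ?_⟩
  · exact Finset.mem_filter.2 ⟨p.2, p, hp, rfl⟩
  · refine Finset.mem_filter.2 ⟨q.2, ?_⟩
    rintro ⟨y, hy, hyq⟩
    exact hq (Subtype.ext hyq ▸ hy)
  · intro x hx y hy hxy
    obtain ⟨-, x', hx', rfl⟩ := Finset.mem_filter.1 hx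
    obtain ⟨hyI, hy⟩ := Finset.mem_filter.1 hy
    exact hAB x' hx' ⟨y, hyI⟩ (fun hyA => hy ⟨_, hyA, rfl⟩) hxy

end EdgeBox

namespace EdgeBox

/-! ### Reduction to connected cuts; bridges -/

section Graph

variable {n : ℕ} {G : SimpleGraph (Fin n)}

theorem mk_lo_hi (e : G.edgeSet) : s(lo e, hi e) = (e : Sym2 (Fin n)) := by
  obtain ⟨e, he⟩ := e
  induction e using Sym2.ind with
  | _ x y =>
    rcases le_total x y with h | h <;> simp [lo, hi, h]

theorem adj_lo_hi (e : G.edgeSet) : G.Adj (lo e) (hi e) := by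
  rw [← SimpleGraph.mem_edgeSet, mk_lo_hi]
  exact e.2

theorem lo_ne_hi (e : G.edgeSet) : lo e ≠ hi e := (adj_lo_hi e).ne

theorem not_separated {A B : Finset (Fin n)} (hno : ∀ x ∈ A, ∀ y ∈ B, ¬ G.Adj x y)
    (e : G.edgeSet) : ¬ (lo e ∈ A ∧ hi e ∈ B) ∧ ¬ (lo e ∈ B ∧ hi e ∈ A) :=
  ⟨fun h => hno _ h.1 _ h.2 (adj_lo_hi e), fun h => hno _ h.2 _ h.1 (adj_lo_hi e).symm⟩

theorem cutCap_compl (l u : G.edgeSet → ℤ) (I : Finset (Fin n)) (e : G.edgeSet) :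
    cutCap lo hi l u Iᶜ e = cutCap lo hi (-u) (-l) I e := by
  simp only [cutCap, Finset.mem_compl, Pi.neg_apply]
  split_ifs <;> simp

theorem cutCap_union (l u : G.edgeSet → ℤ) {A B : Finset (Fin n)} (hdis : Disjoint A B)
    (hno : ∀ x ∈ A, ∀ y ∈ B, ¬ G.Adj x y) (e : G.edgeSet) :
    cutCap lo hi l u (A ∪ B) e = cutCap lo hi l u A e + cutCap lo hi l u B e := by
  have hd : ∀ x ∈ A, x ∉ B := fun x hx hx' => Finset.disjoint_left.1 hdis hx hx'
  have h1 := not_separated hno e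
  have h2 := hd (lo e)
  have h3 := hd (hi e)
  simp only [cutCap, Finset.mem_union]
  grind

variable [DecidableRel G.Adj]

theorem mem_cut {I : Finset (Fin n)} {e : G.edgeSet} :
    e ∈ cut G I ↔ (lo e ∈ I ∧ hi e ∉ I) ∨ (lo e ∉ I ∧ hi e ∈ I) := by
  simp only [cut, Finset.mem_filter, Finset.mem_univ, true_and, ← mk_lo_hi, Sym2.eq_iff]
  constructor
  · rintro ⟨i, hi, j, hj, ⟨h1, h2⟩ | ⟨h1, h2⟩⟩
    · exact Or.inl ⟨h1 ▸ hi, h2 ▸ hj⟩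
    · exact Or.inr ⟨h1 ▸ hj, h2 ▸ hi⟩
  · rintro (⟨h1, h2⟩ | ⟨h1, h2⟩)
    · exact ⟨_, h1, _, h2, Or.inl ⟨rfl, rfl⟩⟩
    · exact ⟨_, h2, _, h1, Or.inr ⟨rfl, rfl⟩⟩

theorem cut_compl (I : Finset (Fin n)) : cut G Iᶜ = cut G I := by
  ext e
  simp only [mem_cut, Finset.mem_compl]
  tauto

theorem cut_nonempty (hG : G.Connected) {I : Finset (Fin n)} (hI : I.Nonempty)
    (hI' : Iᶜ.Nonempty) : (cut G I).Nonempty := by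
  obtain ⟨p, hp⟩ := hI
  obtain ⟨q, hq⟩ := hI'
  obtain ⟨w⟩ := hG.preconnected p q
  obtain ⟨d, -, h1, h2⟩ := w.exists_boundary_dart (I : Set (Fin n)) (by simpa using hp)
    (by simpa using hq)
  exact ⟨⟨s(d.fst, d.snd), d.adj⟩, Finset.mem_filter.2
    ⟨Finset.mem_univ _, d.fst, by simpa using h1, d.snd, by simpa using h2, rfl⟩⟩

/-- Edges of the cut of `A` avoid `B`, so they survive in the union; by connectedness `B` has cut
edges too, and these are new. -/
theorem cut_card_lt (hG : G.Connected) {A B : Finset (Fin n)} (hA : A.Nonempty)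
    (hB : B.Nonempty) (hdis : Disjoint A B) (hno : ∀ x ∈ A, ∀ y ∈ B, ¬ G.Adj x y) :
    (cut G A).card < (cut G (A ∪ B)).card := by
  have hd : ∀ x ∈ A, x ∉ B := fun x hx hx' => Finset.disjoint_left.1 hdis hx hx'
  refine Finset.card_lt_card (Finset.ssubset_iff_subset_ne.2 ⟨fun e he => ?_, fun heq => ?_⟩)
  · have := not_separated hno e
    rw [mem_cut] at he ⊢
    simp only [Finset.mem_union]
    tauto
  · obtain ⟨e, he⟩ := cut_nonempty hG hB
      (hA.mono fun x hx => Finset.mem_compl.2 (hd x hx))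
    have h1 := not_separated hno e
    have h2 : e ∈ cut G A ↔ e ∈ cut G (A ∪ B) := by rw [heq]
    have := hd (lo e)
    have := hd (hi e)
    rw [mem_cut] at he
    simp only [mem_cut, Finset.mem_union] at h2
    tauto

/-- The capacity inequality for the cuts with both sides connected implies it for all cuts. -/
theorem cut_of_connected_cut (hG : G.Connected) {τ : Fin n → ℤ} (hτ : ∑ i, τ i = 0)
    (l u : G.edgeSet → ℤ)
    (h : ∀ I : Finset (Fin n), I.Nonempty → I ≠ Finset.univ →
      (G.induce (I : Set (Fin n))).Connected → (G.induce ((I : Set (Fin n))ᶜ)).Connected →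
      ∑ i ∈ I, τ i ≤ ∑ e, cutCap lo hi l u I e) (I : Finset (Fin n)) :
    ∑ i ∈ I, τ i ≤ ∑ e, cutCap lo hi l u I e := by
  induction hN : (cut G I).card using Nat.strong_induction_on generalizing I with
  | _ N ih =>
  rcases I.eq_empty_or_nonempty with rfl | hI
  · simp [cutCap]
  by_cases hI' : I = Finset.univ
  · simp [hI', hτ, cutCap]
  by_cases h1 : (G.induce (I : Set (Fin n))).Connected
  · by_cases h2 : (G.induce ((I : Set (Fin n))ᶜ)).Connected
    · exact h I hI hI' h1 h2
    · rw [← Finset.coe_compl] at h2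
      have hc : Iᶜ.Nonempty := by
        rwa [Finset.nonempty_iff_ne_empty, ne_eq, Finset.compl_eq_empty_iff]
      obtain ⟨A, B, hA, hB, hdis, hAB, hno⟩ := exists_finset_separation hc h2
      have hno' : ∀ x ∈ B, ∀ y ∈ A, ¬ G.Adj x y := fun x hx y hy hxy => hno y hy x hx hxy.symm
      have hAlt := cut_card_lt hG hA hB hdis hno
      have hBlt := cut_card_lt hG hB hA hdis.symm hno'
      rw [Finset.union_comm] at hBlt
      rw [hAB, cut_compl, hN, ← cut_compl] at hAlt hBlt
      have hA' := ih _ hAlt Aᶜ rfl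
      have hB' := ih _ hBlt Bᶜ rfl
      have hcap : ∑ e, cutCap lo hi l u I e =
          ∑ e, cutCap lo hi l u Aᶜ e + ∑ e, cutCap lo hi l u Bᶜ e := by
        rw [← Finset.sum_add_distrib]
        refine Finset.sum_congr rfl fun e _ => ?_
        rw [← compl_compl I, ← hAB, cutCap_compl, cutCap_compl, cutCap_compl,
          cutCap_union _ _ hdis hno]
      -- The total of `τ` is zero, so its sums over `Aᶜ` and `Bᶜ` add up to that over `I`.
      have e1 := Finset.sum_add_sum_compl A τ
      have e2 := Finset.sum_add_sum_compl B τ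
      have e3 := Finset.sum_add_sum_compl I τ
      rw [← hAB, Finset.sum_union hdis] at e3
      omega
  · obtain ⟨A, B, hA, hB, hdis, rfl, hno⟩ := exists_finset_separation hI h1
    have hno' : ∀ x ∈ B, ∀ y ∈ A, ¬ G.Adj x y := fun x hx y hy hxy => hno y hy x hx hxy.symm
    have hAlt := cut_card_lt hG hA hB hdis hno
    have hBlt := cut_card_lt hG hB hA hdis.symm hno'
    rw [Finset.union_comm] at hBlt
    rw [hN] at hAlt hBlt
    have hA' := ih _ hAlt A rfl
    have hB' := ih _ hBlt B rfl
    rw [Finset.sum_union hdis, Finset.sum_congr rfl fun e _ => cutCap_union l u hdis hno e,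
      Finset.sum_add_distrib]
    omega

/-- The capacity inequality for the two sides of a bridge bounds the flow on it consistently. -/
theorem lower_le_upper_of_bridge (hG : G.Connected) {τ : Fin n → ℤ} (hτ : ∑ i, τ i = 0)
    (l u : G.edgeSet → ℤ) (hcut : ∀ I : Finset (Fin n), ∑ i ∈ I, τ i ≤ ∑ e, cutCap lo hi l u I e)
    (e : G.edgeSet) (he : ¬ (G.deleteEdges {(e : Sym2 (Fin n))}).Connected) : l e ≤ u e := by
  classical
  have := hG.nonempty
  obtain ⟨A, hA, hA', hsep⟩ := exists_separation_of_not_connected he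
  have hsep' : ∀ k : G.edgeSet, k ≠ e → (lo k ∈ A ↔ hi k ∈ A) := fun k hk => by
    have hadj : (G.deleteEdges {(e : Sym2 (Fin n))}).Adj (lo k) (hi k) := by
      rw [SimpleGraph.deleteEdges_adj, mk_lo_hi]
      exact ⟨adj_lo_hi k, fun h => hk (Subtype.ext h)⟩
    exact ⟨fun h1 => by_contra fun h2 => hsep _ h1 _ h2 hadj,
      fun h1 => by_contra fun h2 => hsep _ h1 _ h2 hadj.symm⟩
  have hcross : ¬ (lo e ∈ A ↔ hi e ∈ A) := fun h => by
    obtain ⟨k, hk⟩ := cut_nonempty (I := A.toFinset) hG (by simpa using hA)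
      (by simpa [← Set.toFinset_compl] using hA')
    rw [mem_cut, Set.mem_toFinset, Set.mem_toFinset] at hk
    rcases eq_or_ne k e with rfl | hke
    · tauto
    · have := hsep' k hke
      tauto
  -- Only `e` crosses between `A` and its complement, so the two capacities are `u e` and `-l e` in
  -- some order, while the demands cancel.
  have hsum : ∑ k, (cutCap lo hi l u A.toFinset k + cutCap lo hi l u A.toFinsetᶜ k) =
      u e - l e := by
    rw [Finset.sum_eq_single e]
    · simp only [cutCap, Finset.mem_compl, Set.mem_toFinset]
      grind
    · intro k _ hk
      have := hsep' k hk
      simp only [cutCap, Finset.mem_compl, Set.mem_toFinset]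
      grind
    · simp
  rw [Finset.sum_add_distrib] at hsum
  have h1 := hcut A.toFinset
  have h2 := hcut A.toFinsetᶜ
  have h3 := Finset.sum_add_sum_compl A.toFinset τ
  omega

end Graph

end EdgeBox

namespace EdgeBox

/-! ### Translation into flows -/

section Reformulation

variable {n m : ℕ} {G : SimpleGraph (Fin n)} [DecidableRel G.Adj]

theorem mulVec_N₀ (ε : Fin m ≃ G.edgeSet) (s : Fin m → ℤ) (i : Fin n) :
    (N₀ ε *ᵥ s) i = netOut lo hi (fun e => s (ε.symm e)) i := by
  rw [Matrix.mulVec, dotProduct, netOut, ← ε.sum_comp]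
  refine Finset.sum_congr rfl fun k _ => ?_
  have := lo_ne_hi (ε k)
  simp only [N₀, Matrix.of_apply, Equiv.symm_apply_apply]
  grind

/-- Here `r` is the net outflow of `x - y` and `N₀ s` that of `x + y`; adding them eliminates `y`
and produces the factor 2 behind the parity condition. -/
theorem eq_sum_iff (ε : Fin m ≃ G.edgeSet) (r : Fin n → ℤ) (s : Fin m → ℤ)
    (x y : G.edgeSet → ℤ) :
    ∑ i, r i • f m i + ∑ j, s j • g n j = ∑ e, x e • z ε e + ∑ e, y e • z' ε e ↔
      (∀ e, s (ε.symm e) = x e + y e) ∧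
        ∀ i, (N₀ ε *ᵥ s + r) i = 2 * netOut lo hi x i := by
  have h1 : (∑ i, r i • f m i + ∑ j, s j • g n j).1 = r := by
    ext i
    simp [f, g, Prod.fst_sum, Finset.sum_apply, Pi.single_apply]
  have h2 : (∑ i, r i • f m i + ∑ j, s j • g n j).2 = s := by
    ext i
    simp [f, g, Prod.snd_sum, Finset.sum_apply, Pi.single_apply]
  have h3 : (∑ e, x e • z ε e + ∑ e, y e • z' ε e).1 =
      fun i => netOut lo hi x i - netOut lo hi y i := by
    ext i
    simp only [netOut, z, z', f, g, Prod.fst_add, Prod.fst_sum, Prod.smul_fst, Prod.fst_sub,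
      Prod.fst_neg, Pi.add_apply, Finset.sum_apply, Pi.smul_apply, Pi.sub_apply, Pi.neg_apply,
      Pi.single_apply, smul_eq_mul, add_zero]
    rw [← Finset.sum_add_distrib, ← Finset.sum_sub_distrib]
    refine Finset.sum_congr rfl fun e _ => ?_
    ring
  have h4 : (∑ e, x e • z ε e + ∑ e, y e • z' ε e).2 = fun k => x (ε k) + y (ε k) := by
    ext k
    simp [z, z', f, g, Prod.snd_sum, Finset.sum_apply, Pi.single_apply, Equiv.eq_symm_apply]
  rw [Prod.ext_iff, h1, h2, h3, h4, funext_iff, funext_iff, and_comm]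
  have h5 : (∀ k, s k = x (ε k) + y (ε k)) ↔ ∀ e, s (ε.symm e) = x e + y e := by
    rw [← ε.forall_congr_right]
    simp
  rw [h5]
  refine and_congr_right fun hs => forall_congr' fun i => ?_
  have h6 : netOut lo hi (fun e => s (ε.symm e)) i = netOut lo hi x i + netOut lo hi y i := by
    unfold netOut
    rw [← Finset.sum_add_distrib]
    refine Finset.sum_congr rfl fun e _ => ?_
    simp only [hs]
    ring
  rw [Pi.add_apply, mulVec_N₀, h6]
  omega

/-- Twice the bound that the choice `J` puts on the flow of `e` out of `I`. -/
def choiceCap (S a b c d : G.edgeSet → ℤ) (I : Finset (Fin n)) (J : Finset G.edgeSet)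
    (e : G.edgeSet) : ℤ :=
  if lo e ∈ I ∧ hi e ∉ I then (if e ∈ J then 2 * (S e - c e) else 2 * b e)
  else if lo e ∉ I ∧ hi e ∈ I then (if e ∈ J then -2 * a e else 2 * (d e - S e))
  else 0

/-- Adding the sum of `N₀ s` over `I` to both sides makes the `s`-term of each cut edge cancel or
double. -/
theorem cut_ineq_iff (ε : Fin m ≃ G.edgeSet) (r : Fin n → ℤ) (s : Fin m → ℤ)
    (a b c d : G.edgeSet → ℤ) (I : Finset (Fin n)) {J : Finset G.edgeSet} (hJ : J ⊆ cut G I) :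
    ∑ i ∈ I, r i + ∑ e ∈ cut G I \ J, s (ε.symm e) - ∑ e ∈ J, s (ε.symm e) ≤
          2 * (∑ e with e ∉ J ∧ lo e ∈ I ∧ hi e ∉ I, b e)
            - 2 * (∑ e with e ∈ J ∧ lo e ∉ I ∧ hi e ∈ I, a e)
            + 2 * (∑ e with e ∉ J ∧ lo e ∉ I ∧ hi e ∈ I, d e)
            - 2 * (∑ e with e ∈ J ∧ lo e ∈ I ∧ hi e ∉ I, c e) ↔
      ∑ i ∈ I, (N₀ ε *ᵥ s + r) i ≤
        ∑ e, choiceCap (fun e => s (ε.symm e)) a b c d I J e := by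
  have hr : ∑ i ∈ I, (N₀ ε *ᵥ s + r) i = ∑ e, s (ε.symm e) *
      ((if lo e ∈ I then 1 else 0) - (if hi e ∈ I then 1 else 0)) + ∑ i ∈ I, r i := by
    simp only [Pi.add_apply, mulVec_N₀]
    rw [Finset.sum_add_distrib, sum_netOut]
  have hs1 : ∑ e ∈ cut G I \ J, s (ε.symm e) =
      ∑ e, if e ∈ cut G I \ J then s (ε.symm e) else 0 := by
    rw [Finset.sum_ite_mem, Finset.univ_inter]
  have hs2 : ∑ e ∈ J, s (ε.symm e) = ∑ e, if e ∈ J then s (ε.symm e) else 0 := by simp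
  have key : ∑ e, choiceCap (fun e => s (ε.symm e)) a b c d I J e =
      2 * (∑ e with e ∉ J ∧ lo e ∈ I ∧ hi e ∉ I, b e)
        - 2 * (∑ e with e ∈ J ∧ lo e ∉ I ∧ hi e ∈ I, a e)
        + 2 * (∑ e with e ∉ J ∧ lo e ∉ I ∧ hi e ∈ I, d e)
        - 2 * (∑ e with e ∈ J ∧ lo e ∈ I ∧ hi e ∉ I, c e)
        - ∑ e ∈ cut G I \ J, s (ε.symm e) + ∑ e ∈ J, s (ε.symm e)
        + ∑ e, s (ε.symm e) *
          ((if lo e ∈ I then 1 else 0) - (if hi e ∈ I then 1 else 0)) := by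
    rw [hs1, hs2]
    simp only [Finset.sum_filter, Finset.mul_sum]
    simp only [← Finset.sum_add_distrib, ← Finset.sum_sub_distrib]
    refine Finset.sum_congr rfl fun e _ => ?_
    have hJe : e ∈ J → e ∈ cut G I := fun h => hJ h
    rw [mem_cut] at hJe
    simp only [choiceCap, Finset.mem_sdiff, mem_cut]
    by_cases h1 : lo e ∈ I <;> by_cases h2 : hi e ∈ I <;> by_cases h3 : e ∈ J <;>
      simp [h1, h2, h3] at hJe ⊢ <;> ring
  rw [hr, key]
  omega

theorem exists_choiceCap_eq (S a b c d : G.edgeSet → ℤ) (I : Finset (Fin n)) :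
    ∃ J ⊆ cut G I, ∀ e, choiceCap S a b c d I J e =
      2 * cutCap lo hi (fun e => max (a e) (S e - d e)) (fun e => min (b e) (S e - c e)) I e := by
  -- `J` collects the cut edges on which its alternative is the tighter one.
  refine ⟨(cut G I).filter fun e =>
    (lo e ∈ I ∧ S e - c e ≤ b e) ∨ (hi e ∈ I ∧ S e - d e ≤ a e), Finset.filter_subset _ _,
    fun e => ?_⟩
  simp only [choiceCap, cutCap, Finset.mem_filter, mem_cut]
  by_cases h1 : lo e ∈ I <;> by_cases h2 : hi e ∈ I <;> simp [h1, h2]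
  · grind
  · grind

theorem flow_le_choiceCap {S a b c d x y : G.edgeSet → ℤ} (hx : ∀ e, a e ≤ x e ∧ x e ≤ b e)
    (hy : ∀ e, c e ≤ y e ∧ y e ≤ d e) (hS : ∀ e, S e = x e + y e) (I : Finset (Fin n))
    (J : Finset G.edgeSet) :
    2 * ∑ i ∈ I, netOut lo hi x i ≤ ∑ e, choiceCap S a b c d I J e := by
  rw [sum_netOut, Finset.mul_sum]
  refine Finset.sum_le_sum fun e _ => ?_
  have := hx e
  have := hy e
  have := hS e
  unfold choiceCap
  by_cases h1 : lo e ∈ I <;> by_cases h2 : hi e ∈ I <;> by_cases h3 : e ∈ J <;>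
    simp [h1, h2, h3] <;> omega

end Reformulation

end EdgeBox

/-! ### The characterization -/

theorem theorem4p11 {n m : ℕ} (G : SimpleGraph (Fin n)) [DecidableRel G.Adj]
    (hG : G.Connected) (ε : Fin m ≃ G.edgeSet)
    (r : Fin n → ℤ) (s : Fin m → ℤ) (a b c d : G.edgeSet → ℤ)
    (hab : ∀ e, a e ≤ b e) (hcd : ∀ e, c e ≤ d e) :
    (∃ x y : G.edgeSet → ℤ,
        (∀ e, a e ≤ x e ∧ x e ≤ b e) ∧ (∀ e, c e ≤ y e ∧ y e ≤ d e) ∧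
        ∑ i, r i • EdgeBox.f m i + ∑ j, s j • EdgeBox.g n j =
          ∑ e, x e • EdgeBox.z ε e + ∑ e, y e • EdgeBox.z' ε e) ↔
      ((∀ i, Even ((EdgeBox.N₀ ε *ᵥ s + r) i)) ∧ ∑ i, (EdgeBox.N₀ ε *ᵥ s + r) i = 0) ∧
      (∀ (I : Finset (Fin n)) (J : Finset G.edgeSet),
        I.Nonempty → I ≠ Finset.univ → J ⊆ EdgeBox.cut G I →
        (G.induce (I : Set (Fin n))).Connected →
        (G.induce ((I : Set (Fin n))ᶜ)).Connected →
        ∑ i ∈ I, r i + ∑ e ∈ EdgeBox.cut G I \ J, s (ε.symm e) - ∑ e ∈ J, s (ε.symm e) ≤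
          2 * (∑ e with e ∉ J ∧ EdgeBox.lo e ∈ I ∧ EdgeBox.hi e ∉ I, b e)
            - 2 * (∑ e with e ∈ J ∧ EdgeBox.lo e ∉ I ∧ EdgeBox.hi e ∈ I, a e)
            + 2 * (∑ e with e ∉ J ∧ EdgeBox.lo e ∉ I ∧ EdgeBox.hi e ∈ I, d e)
            - 2 * (∑ e with e ∈ J ∧ EdgeBox.lo e ∈ I ∧ EdgeBox.hi e ∉ I, c e)) ∧
      (∀ k : Fin m, (G.deleteEdges {(ε k : Sym2 (Fin n))}).Connected →
        a (ε k) + c (ε k) ≤ s k ∧ s k ≤ b (ε k) + d (ε k)) := by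
  constructor
  · rintro ⟨x, y, hx, hy, heq⟩
    rw [EdgeBox.eq_sum_iff] at heq
    obtain ⟨hs, ht⟩ := heq
    refine ⟨⟨fun i => ⟨_, (ht i).trans (two_mul _)⟩, ?_⟩, fun I J _ _ hJ _ _ => ?_, fun k _ => ?_⟩
    · simp only [ht]
      rw [← Finset.mul_sum, EdgeBox.sum_netOut]
      simp
    · rw [EdgeBox.cut_ineq_iff ε r s a b c d I hJ]
      simp only [ht]
      rw [← Finset.mul_sum]
      exact EdgeBox.flow_le_choiceCap hx hy hs I J
    · have h := hs (ε k)
      rw [Equiv.symm_apply_apply] at h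
      have := hx (ε k)
      have := hy (ε k)
      omega
  · rintro ⟨⟨heven, hsum⟩, hcut, hbd⟩
    choose τ hτ using heven
    have ht : ∀ i, (EdgeBox.N₀ ε *ᵥ s + r) i = 2 * τ i := fun i => by rw [hτ, two_mul]
    have hτ0 : ∑ i, τ i = 0 := by
      simp only [ht] at hsum
      rw [← Finset.mul_sum] at hsum
      omega
    set S : G.edgeSet → ℤ := fun e => s (ε.symm e) with hS
    set l : G.edgeSet → ℤ := fun e => max (a e) (S e - d e) with hl
    set u : G.edgeSet → ℤ := fun e => min (b e) (S e - c e) with hu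
    have hall : ∀ I : Finset (Fin n),
        ∑ i ∈ I, τ i ≤ ∑ e, EdgeBox.cutCap EdgeBox.lo EdgeBox.hi l u I e := by
      refine EdgeBox.cut_of_connected_cut hG hτ0 l u fun I hI hI' h1 h2 => ?_
      obtain ⟨J, hJ, hcap⟩ := EdgeBox.exists_choiceCap_eq S a b c d I
      have h := (EdgeBox.cut_ineq_iff ε r s a b c d I hJ).1 (hcut I J hI hI' hJ h1 h2)
      simp only [ht] at h
      rw [← Finset.mul_sum, Finset.sum_congr rfl fun e _ => hcap e, ← Finset.mul_sum] at h
      exact le_of_mul_le_mul_left h two_pos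
    have hlu : ∀ e, l e ≤ u e := fun e => by
      by_cases he : (G.deleteEdges {(e : Sym2 (Fin n))}).Connected
      · have h := hbd (ε.symm e) (by rwa [Equiv.apply_symm_apply])
        rw [Equiv.apply_symm_apply] at h
        have := hab e
        have := hcd e
        simp only [hl, hu, hS]
        omega
      · exact EdgeBox.lower_le_upper_of_bridge hG hτ0 l u hall e he
    obtain ⟨x, hx, hxτ⟩ := EdgeBox.exists_flow_of_cut _ _ hτ0 l u hlu hall
    refine ⟨x, fun e => S e - x e, fun e => ?_, fun e => ?_, ?_⟩
    · have := hx e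
      simp only [hl, hu] at this
      omega
    · have := hx e
      simp only [hl, hu] at this ⊢
      omega
    · rw [EdgeBox.eq_sum_iff]
      exact ⟨fun e => by ring, fun i => by rw [ht, hxτ]⟩
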